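/- **Setting.** Let $a,b,c_0,\bar c_1,\gamma,\delta,r,T$ be real numbers with $b,\gamma,\delta,r,T>0$, $c_0<a$ and $c_0\le\bar c_1$. Admissible controls are the functions in $L^2(0,T)$. An output $u_1$ of the follower (firm 1) generates the knowledge stock $x_1$ with $\dot x_1=u_1-\delta x_1$, $x_1(0)=0$, and his unit cost is $c_1(x_1)=\bar c_1-\gamma x_1$. The payoffs of the leader (firm 0) and of the follower are $$J_0(u_0,u_1)=\int_0^Te^{-rt}u_0\,(a-b(u_1+u_0)-c_0)\,dt,\qquad J_1(u_0,u_1)=\int_0^Te^{-rt}u_1\,(a-b(u_1+u_0)-c_1(x_1(t)))\,dt .$$ A best reply of the follower to $u_0$ is an admissible $u_1$ which, for the path $t\mapsto c_1(x_1(t))$ of unit costs that $u_1$ itself generates, maximizes $v\mapsto\int_0^Te^{-rt}v\,(a-b(v+u_0)-c_1(x_1(t)))\,dt$ over admissible $v$ with this cost path held fixed (equivalently $u_1=(a-bu_0+\gamma x_1-\bar c_1)/(2b)$ almost everywhere). An open-loop Stackelberg equilibrium is a pair $(u_0^*,u_1^*)$ of admissible controls such that $u_1^*$ is a best reply to $u_0^*$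 and $J_0(v_0,v_1)\le J_0(u_0^*,u_1^*)$ for all admissible $v_0$ and all best replies $v_1$ to $v_0$. Put $a'=a-c_0$, $c'=\bar c_1-c_0$, $$\Delta=r^2+4\delta(r+\delta)-\frac{3\gamma}{b}(r+2\delta)+\frac{2\gamma^2}{b^2},\qquad s_{1}=\frac{r-\sqrt\Delta}2,\quad s_2=\frac{r+\sqrt\Delta}2,$$ $q_i=4b\big(s_i+\delta-\frac{3\gamma}{4b}\big)$, $\alpha_i=q_i(a'-3c')-\gamma(a'+c')$, $$\tilde\lambda=\frac{q_1\alpha_2s_2(e^{s_1T}-1)-q_2\alpha_1s_1(e^{s_2T}-1)}{4bs_1s_2(q_1e^{s_1T}-q_2e^{s_2T})},$$ $$x^*(t)=\tfrac1{4b\sqrt\Delta}\Big(\tilde\lambda(e^{s_2t}-e^{s_1t})+\tfrac{\alpha_2}{4bs_1}(e^{s_1t}-1)-\tfrac{\alpha_1}{4bs_2}(e^{s_2t}-1)\Big),$$ $$\lambda^*(t)=\tfrac1{4b\sqrt\Delta}\Big(\tilde\lambda(q_2e^{s_2t}-q_1e^{s_1t})+\tfrac{q_1\alpha_2}{4bs_1}(e^{s_1t}-1)-\tfrac{q_2\alpha_1}{4bs_2}(e^{s_2t}-1)\Big),$$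 $$u_0^*=\frac{a'+c'-\gamma x^*-\lambda^*}{2b},\qquad u_1^*=\frac{a'-3c'+3\gamma x^*+\lambda^*}{4b},\qquad \hat u_0=\frac{3(a'+c'-\gamma x^*)-\lambda^*}{8b}.$$ For a defection time $t_0$ and $k>0$ let $\rho(t)=1$ for $t\le t_0$ and $\rho(t)=e^{-k(t-t_0)}$ for $t>t_0$, let $J_0^*=J_0(u_0^*,u_1^*)$, and let $$\tilde J_0=\int_0^{t_0}e^{-rt}u_0^*(a-b(u_0^*+u_1^*)-c_0)\,dt+\int_{t_0}^Te^{-rt}\rho(t)\,\hat u_0(a-b(\hat u_0+u_1^*)-c_0)\,dt .$$ Put $X_1=\frac{1}{4b\sqrt\Delta}\big(\frac{\alpha_2}{4bs_1}-\tilde\lambda\big)$, $X_2=\frac{1}{4b\sqrt\Delta}\big(\tilde\lambda-\frac{\alpha_1}{4bs_2}\big)$, $E_0=a'+c'-\frac{\gamma}{4b\sqrt\Delta}\big(\frac{\alpha_1}{4bs_2}-\frac{\alpha_2}{4bs_1}\big)$, $L_0=\frac{1}{4b\sqrt\Delta}\big(\frac{q_2\alpha_1}{4bs_2}-\frac{q_1\alpha_2}{4bs_1}\big)$,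 and, for $i=1,2$, $$A_i=-16e^{(s_i-r)t_0}X_i(\gamma E_0+q_iL_0),\quad A_{2+i}=8e^{(2s_i-r)t_0}X_i^2(\gamma^2-q_i^2),$$ $$A_5=16e^{(s_1+s_2-r)t_0}X_1X_2(\gamma^2-q_1q_2),\quad A_6=8e^{-rt_0}(E_0^2-L_0^2),$$ $$A_{6+i}=2e^{(s_i-r)t_0}X_i(3\gamma+q_i)(3E_0-L_0),\quad A_{8+i}=-e^{(2s_i-r)t_0}X_i^2(3\gamma+q_i)^2,$$ $$A_{11}=-2e^{(s_1+s_2-r)t_0}X_1X_2(3\gamma+q_1)(3\gamma+q_2),\quad A_{12}=-e^{-rt_0}(3E_0-L_0)^2 .$$ **Theorem.** Assume $\Delta>r^2$ and $2\gamma<b(r+2\delta)$, and let $0\le t_0<T$. Then: 1. $s_1<0<s_2$ are eigenvalues of the matrix of the linear two-point boundary value problem $$\begin{pmatrix}\dot x\\ \dot\lambda\end{pmatrix}=\begin{pmatrix}\frac{3\gamma}{4b}-\delta&\frac1{4b}\\-\frac{\gamma^2}{4b}&r+\delta-\frac{3\gamma}{4b}\end{pmatrix}\begin{pmatrix}x\\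 \lambda\end{pmatrix}+\frac1{4b}\begin{pmatrix}a'-3c'\\ \gamma(a'+c')\end{pmatrix},\qquad x(0)=0,\ \lambda(T)=0,$$ and $(x^*,\lambda^*)$ solves this problem on $[0,T]$. 2. $x^*$ is the knowledge stock generated by $u_1^*$; $(u_0^*,u_1^*)$ is an open-loop Stackelberg equilibrium; and $\hat u_0$ maximizes $\int_{t_0}^Te^{-rt}v(a-b(v+u_1^*)-c_0)\,dt$ over admissible $v$. 3. With $\tau=T-t_0$, consider the condition on $k>0$ $$\begin{aligned}&A_1\tfrac{e^{(s_1-r)\tau}-1}{s_1-r}+A_2\tfrac{e^{(s_2-r)\tau}-1}{s_2-r}+A_3\tfrac{e^{(2s_1-r)\tau}-1}{2s_1-r}+A_4\tfrac{e^{(2s_2-r)\tau}-1}{2s_2-r}+A_5\tfrac{e^{(s_1+s_2-r)\tau}-1}{s_1+s_2-r}-A_6\tfrac{e^{-r\tau}-1}{r}\\&+A_7\tfrac{e^{(s_1-k-r)\tau}-1}{s_1-k-r}+A_8\tfrac{e^{(s_2-k-r)\tau}-1}{s_2-k-r}+A_9\tfrac{e^{(2s_1-k-r)\tau}-1}{2s_1-k-r}+A_{10}\tfrac{e^{(2s_2-k-r)\tau}-1}{2s_2-k-r}+A_{11}\tfrac{e^{(s_1+s_2-k-r)\tau}-1}{s_1+s_2-k-r}-A_{12}\tfrac{e^{-(k+r)\tau}-1}{k+r}\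 \ge 0,\end{aligned}\tag{$*$}$$ where $\frac{e^{z\tau}-1}{z}$ is read as its limit $\tau$ when $z=0$. For every $k>0$, $(*)$ holds if and only if $\tilde J_0\le J_0^*$, and it holds with strict inequality if and only if $\tilde J_0<J_0^*$. 4. There exists $k>0$ that satisfies $(*)$ and for which $\tilde J_0<J_0^*$. -/

import Mathlib

open MeasureTheory Set

noncomputable section

/-- The data of the finite-horizon dynamic Stackelberg duopoly: inverse demand
`a - b (u₀ + u₁)`, constant unit cost `c₀` of the leader (firm 0), unit cost `cbar - γ x₁` of the
follower (firm 1) with knowledge stock `x₁`, depreciation rate `δ` of knowledge, interest rate `r`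
and horizon `T`. -/
structure Duopoly where
  a : ℝ
  b : ℝ
  c₀ : ℝ
  cbar : ℝ
  γ : ℝ
  δ : ℝ
  r : ℝ
  T : ℝ
  b_pos : 0 < b
  γ_pos : 0 < γ
  δ_pos : 0 < δ
  r_pos : 0 < r
  T_pos : 0 < T
  c₀_lt_a : c₀ < a
  c₀_le_cbar : c₀ ≤ cbar

namespace Duopoly

variable (G : Duopoly)

/-! ### The game -/

/-- Admissible (open-loop) controls: square-integrable functions on `[0, T]`. -/
def Admissible (u : ℝ → ℝ) : Prop :=
  MemLp u 2 (volume.restrict (Icc 0 G.T))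

/-- Learning-by-doing: unit cost of the follower at knowledge stock `x`. -/
def followerCost (x : ℝ) : ℝ := G.cbar - G.γ * x

/-- `x` is the knowledge stock generated by the output `u₁`:
`x' = u₁ - δ x` on `[0, T]`, `x 0 = 0`, in integrated form. -/
def IsKnowledge (u₁ x : ℝ → ℝ) : Prop :=
  ContinuousOn x (Icc 0 G.T) ∧
    ∀ t ∈ Icc 0 G.T, x t = ∫ s in (0 : ℝ)..t, (u₁ s - G.δ * x s)

/-- Instantaneous profit of the leader. -/
def leaderProfit (u₀ u₁ : ℝ) : ℝ := u₀ * (G.a - G.b * (u₁ + u₀) - G.c₀)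

/-- Payoff `J₀` of the leader. -/
def leaderPayoff (u₀ u₁ : ℝ → ℝ) : ℝ :=
  ∫ t in (0 : ℝ)..G.T, Real.exp (-G.r * t) * G.leaderProfit (u₀ t) (u₁ t)

/-- Payoff `J₁` of the follower along the path `c` of his unit cost. -/
def followerPayoff (c u₀ u₁ : ℝ → ℝ) : ℝ :=
  ∫ t in (0 : ℝ)..G.T,
    Real.exp (-G.r * t) * (u₁ t * (G.a - G.b * (u₁ t + u₀ t) - c t))

/-- `u₁` is a best reply of the follower to `u₀`: with `x` the knowledge stock that `u₁` generates,
`u₁` maximizes the follower's payoff for the unit-cost path `c₁(x(t))`. The follower takes the path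
of his unit cost as given when he optimizes, so that the reply is
`u₁ = (a - b u₀ + γ x - cbar) / (2 b)`, the stock `x` being the one produced by that reply. -/
def IsBestReply (u₀ u₁ : ℝ → ℝ) : Prop :=
  G.Admissible u₁ ∧ ∃ x : ℝ → ℝ, G.IsKnowledge u₁ x ∧
    ∀ v : ℝ → ℝ, G.Admissible v →
      G.followerPayoff (fun t => G.followerCost (x t)) u₀ v ≤
        G.followerPayoff (fun t => G.followerCost (x t)) u₀ u₁

/-- Open-loop Stackelberg equilibrium: the follower replies optimally to the leader's announced
path, and the leader's path is optimal against optimal replies. -/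
def IsStackelbergEquilibrium (u₀ u₁ : ℝ → ℝ) : Prop :=
  G.Admissible u₀ ∧ G.IsBestReply u₀ u₁ ∧
    ∀ v₀ v₁ : ℝ → ℝ, G.Admissible v₀ → G.IsBestReply v₀ v₁ →
      G.leaderPayoff v₀ v₁ ≤ G.leaderPayoff u₀ u₁

/-- `w` is an optimal defection of the leader on `[t₀, T]` against the fixed output path `u₁`. -/
def IsOptimalDefection (t₀ : ℝ) (u₁ w : ℝ → ℝ) : Prop :=
  G.Admissible w ∧ ∀ v : ℝ → ℝ, G.Admissible v →
    (∫ t in t₀..G.T, Real.exp (-G.r * t) * G.leaderProfit (v t) (u₁ t)) ≤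
      ∫ t in t₀..G.T, Real.exp (-G.r * t) * G.leaderProfit (w t) (u₁ t)

/-- The discount factor imposed by the third party after a defection at time `t₀`. -/
def discount (t₀ k t : ℝ) : ℝ := if t ≤ t₀ then 1 else Real.exp (-k * (t - t₀))

/-- Actual payoff of a leader who plays `u₀` up to time `t₀` and then defects to `w`. -/
def defectionPayoff (t₀ k : ℝ) (u₀ u₁ w : ℝ → ℝ) : ℝ :=
  (∫ t in (0 : ℝ)..t₀, Real.exp (-G.r * t) * G.leaderProfit (u₀ t) (u₁ t)) +
    ∫ t in t₀..G.T,
      Real.exp (-G.r * t) * discount t₀ k t * G.leaderProfit (w t) (u₁ t)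

/-! ### The state-adjoint system of the leader's problem and its explicit solution -/

/-- Demand intercept net of the leader's cost. -/
def a' : ℝ := G.a - G.c₀

/-- Initial cost disadvantage of the follower. -/
def c' : ℝ := G.cbar - G.c₀

/-- Matrix of the linear system for `(x₁, lam)`. -/
def systemMatrix : Matrix (Fin 2) (Fin 2) ℝ :=
  !![3 * G.γ / (4 * G.b) - G.δ, 1 / (4 * G.b);
     -(G.γ ^ 2 / (4 * G.b)), G.r + G.δ - 3 * G.γ / (4 * G.b)]

/-- Inhomogeneity of the linear system for `(x₁, lam)`. -/
def systemForcing : Fin 2 → ℝ :=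
  ![(G.a' - 3 * G.c') / (4 * G.b), G.γ * (G.a' + G.c') / (4 * G.b)]

/-- The two-point boundary value problem: knowledge stock `x` and adjoint variable `lam`. -/
def SolvesBoundaryValueProblem (x lam : ℝ → ℝ) : Prop :=
  (∀ t ∈ Icc 0 G.T,
    HasDerivWithinAt (fun τ => ![x τ, lam τ])
      (G.systemMatrix.mulVec ![x t, lam t] + G.systemForcing) (Icc 0 G.T) t) ∧
    x 0 = 0 ∧ lam G.T = 0

/-- Discriminant of the characteristic polynomial of `systemMatrix`. -/
def Δ : ℝ :=
  G.r ^ 2 + 4 * G.δ * (G.r + G.δ) - 3 * G.γ / G.b * (G.r + 2 * G.δ) + 2 * G.γ ^ 2 / G.b ^ 2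

def s₁ : ℝ := (G.r - √G.Δ) / 2

def s₂ : ℝ := (G.r + √G.Δ) / 2

def q₁ : ℝ := 4 * G.b * (G.s₁ + G.δ - 3 * G.γ / (4 * G.b))

def q₂ : ℝ := 4 * G.b * (G.s₂ + G.δ - 3 * G.γ / (4 * G.b))

def α₁ : ℝ := G.q₁ * (G.a' - 3 * G.c') - G.γ * (G.a' + G.c')

def α₂ : ℝ := G.q₂ * (G.a' - 3 * G.c') - G.γ * (G.a' + G.c')

/-- Initial value of the adjoint variable. -/
def lam₀ : ℝ :=
  (G.q₁ * G.α₂ * G.s₂ * (Real.exp (G.s₁ * G.T) - 1) -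
      G.q₂ * G.α₁ * G.s₁ * (Real.exp (G.s₂ * G.T) - 1)) /
    (4 * G.b * G.s₁ * G.s₂ *
      (G.q₁ * Real.exp (G.s₁ * G.T) - G.q₂ * Real.exp (G.s₂ * G.T)))

/-- Knowledge stock of the follower in equilibrium. -/
def xStar (t : ℝ) : ℝ :=
  1 / (4 * G.b * √G.Δ) *
    (G.lam₀ * (Real.exp (G.s₂ * t) - Real.exp (G.s₁ * t)) +
      G.α₂ / (4 * G.b * G.s₁) * (Real.exp (G.s₁ * t) - 1) -
      G.α₁ / (4 * G.b * G.s₂) * (Real.exp (G.s₂ * t) - 1))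

/-- Adjoint variable in equilibrium. -/
def lamStar (t : ℝ) : ℝ :=
  1 / (4 * G.b * √G.Δ) *
    (G.lam₀ * (G.q₂ * Real.exp (G.s₂ * t) - G.q₁ * Real.exp (G.s₁ * t)) +
      G.q₁ * G.α₂ / (4 * G.b * G.s₁) * (Real.exp (G.s₁ * t) - 1) -
      G.q₂ * G.α₁ / (4 * G.b * G.s₂) * (Real.exp (G.s₂ * t) - 1))

/-- The leader's equilibrium output. -/
def u₀Star (t : ℝ) : ℝ := (G.a' + G.c' - G.γ * G.xStar t - G.lamStar t) / (2 * G.b)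

/-- The follower's equilibrium output. -/
def u₁Star (t : ℝ) : ℝ :=
  (G.a' - 3 * G.c' + 3 * G.γ * G.xStar t + G.lamStar t) / (4 * G.b)

/-- The leader's defection strategy. -/
def u₀Hat (t : ℝ) : ℝ :=
  (3 * (G.a' + G.c' - G.γ * G.xStar t) - G.lamStar t) / (8 * G.b)

/-! ### The explicit condition on the penalty rate `k` -/

/-- `(e^{z τ} - 1) / z`, with its limit `τ` at `z = 0`. -/
def expQuot (z τ : ℝ) : ℝ := if z = 0 then τ else (Real.exp (z * τ) - 1) / z

/-- Coefficient of `e^{s₁ t}` in `xStar`. -/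
def X₁ : ℝ := (G.α₂ / (4 * G.b * G.s₁) - G.lam₀) / (4 * G.b * √G.Δ)

/-- Coefficient of `e^{s₂ t}` in `xStar`. -/
def X₂ : ℝ := (G.lam₀ - G.α₁ / (4 * G.b * G.s₂)) / (4 * G.b * √G.Δ)

/-- Constant part of `a' + c' - γ xStar`. -/
def E₀ : ℝ :=
  G.a' + G.c' -
    G.γ * ((G.α₁ / (4 * G.b * G.s₂) - G.α₂ / (4 * G.b * G.s₁)) / (4 * G.b * √G.Δ))

/-- Constant part of `lamStar`. -/
def L₀ : ℝ :=
  (G.q₂ * G.α₁ / (4 * G.b * G.s₂) - G.q₁ * G.α₂ / (4 * G.b * G.s₁)) / (4 * G.b * √G.Δ)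

variable (t₀ : ℝ)

def A₁ : ℝ :=
  -(16 * Real.exp ((G.s₁ - G.r) * t₀) * G.X₁ * (G.γ * G.E₀ + G.q₁ * G.L₀))

def A₂ : ℝ :=
  -(16 * Real.exp ((G.s₂ - G.r) * t₀) * G.X₂ * (G.γ * G.E₀ + G.q₂ * G.L₀))

def A₃ : ℝ :=
  8 * Real.exp ((2 * G.s₁ - G.r) * t₀) * G.X₁ ^ 2 * (G.γ ^ 2 - G.q₁ ^ 2)

def A₄ : ℝ :=
  8 * Real.exp ((2 * G.s₂ - G.r) * t₀) * G.X₂ ^ 2 * (G.γ ^ 2 - G.q₂ ^ 2)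

def A₅ : ℝ :=
  16 * Real.exp ((G.s₁ + G.s₂ - G.r) * t₀) * G.X₁ * G.X₂ * (G.γ ^ 2 - G.q₁ * G.q₂)

def A₆ : ℝ :=
  8 * Real.exp (-G.r * t₀) * (G.E₀ ^ 2 - G.L₀ ^ 2)

def A₇ : ℝ :=
  2 * Real.exp ((G.s₁ - G.r) * t₀) * G.X₁ * (3 * G.γ + G.q₁) * (3 * G.E₀ - G.L₀)

def A₈ : ℝ :=
  2 * Real.exp ((G.s₂ - G.r) * t₀) * G.X₂ * (3 * G.γ + G.q₂) * (3 * G.E₀ - G.L₀)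

def A₉ : ℝ :=
  -(Real.exp ((2 * G.s₁ - G.r) * t₀) * G.X₁ ^ 2 * (3 * G.γ + G.q₁) ^ 2)

def A₁₀ : ℝ :=
  -(Real.exp ((2 * G.s₂ - G.r) * t₀) * G.X₂ ^ 2 * (3 * G.γ + G.q₂) ^ 2)

def A₁₁ : ℝ :=
  -(2 * Real.exp ((G.s₁ + G.s₂ - G.r) * t₀) * G.X₁ * G.X₂ *
    (3 * G.γ + G.q₁) * (3 * G.γ + G.q₂))

def A₁₂ : ℝ :=
  -(Real.exp (-G.r * t₀) * (3 * G.E₀ - G.L₀) ^ 2)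

/-- Left-hand side of the condition on `k`, for a defection at time `t₀`; the horizon that remains
is `T - t₀`, which is `T` for a defection at time `0`. -/
def penaltyExpr (k : ℝ) : ℝ :=
  G.A₁ t₀ * expQuot (G.s₁ - G.r) (G.T - t₀) +
  G.A₂ t₀ * expQuot (G.s₂ - G.r) (G.T - t₀) +
  G.A₃ t₀ * expQuot (2 * G.s₁ - G.r) (G.T - t₀) +
  G.A₄ t₀ * expQuot (2 * G.s₂ - G.r) (G.T - t₀) +
  G.A₅ t₀ * expQuot (G.s₁ + G.s₂ - G.r) (G.T - t₀) -
  G.A₆ t₀ * (Real.exp (-G.r * (G.T - t₀)) - 1) / G.r +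
  G.A₇ t₀ * expQuot (G.s₁ - k - G.r) (G.T - t₀) +
  G.A₈ t₀ * expQuot (G.s₂ - k - G.r) (G.T - t₀) +
  G.A₉ t₀ * expQuot (2 * G.s₁ - k - G.r) (G.T - t₀) +
  G.A₁₀ t₀ * expQuot (2 * G.s₂ - k - G.r) (G.T - t₀) +
  G.A₁₁ t₀ * expQuot (G.s₁ + G.s₂ - k - G.r) (G.T - t₀) -
  G.A₁₂ t₀ * (Real.exp (-(k + G.r) * (G.T - t₀)) - 1) / (k + G.r)

end Duopoly

end

open MeasureTheory Set

namespace Duopoly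

variable (G : Duopoly)

/-! ### Spectral data -/

/-! The matrix has trace `r` and eigenvectors `(1, qᵢ)`, so `(x*, λ*)` is a rest point plus one
exponential mode per eigenvalue; `lam₀` is what the terminal condition forces.

Optimality comes from an exact identity rather than from a maximum principle. The follower's payoff
along a frozen cost path is a strictly concave quadratic in his output at each instant, so best
replies are exactly the pointwise `reply`, almost everywhere. If the leader deviates by `h` and the
stock then moves by `y`, we have `y' = κ y - h/2`, and twice the change in his payoff is the
integral of a linear plus quadratic form in `(h, y)`. Subtracting the derivative of `-e^{-rt}(2 λ* y
+ γ y²)` removes the linear part and completes the square. What remains is minus a sum of squares,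
because `2γ < b(r + 2δ)` (`integral_deviation`, `leaderPayoff_le`).

For the penalty, `64 b` times each profit is a quadratic expression in `x*` and `λ*`. Expanding it
in exponentials and integrating termwise gives `penaltyExpr_eq`: the left side of the condition is
`64 b (J₀* - J̃₀)`. As `k` grows the payoff after defection is `O(1/k)`, so a deterring `k` exists
once the remaining equilibrium payoff is positive. The identity above, started at `t₀` with the
deviation "produce nothing", gives this positivity (`integral_leaderProfit_star_pos`). -/

lemma sq_sqrt_Δ (hΔ : G.r ^ 2 < G.Δ) : √G.Δ ^ 2 = G.Δ :=
  Real.sq_sqrt (le_trans (sq_nonneg _) hΔ.le)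

lemma r_lt_sqrt_Δ (hΔ : G.r ^ 2 < G.Δ) : G.r < √G.Δ :=
  Real.lt_sqrt_of_sq_lt hΔ

lemma sqrt_Δ_pos (hΔ : G.r ^ 2 < G.Δ) : 0 < √G.Δ :=
  G.r_pos.trans (G.r_lt_sqrt_Δ hΔ)

lemma s₁_neg (hΔ : G.r ^ 2 < G.Δ) : G.s₁ < 0 := by
  have := G.r_lt_sqrt_Δ hΔ
  unfold s₁; linarith

lemma s₂_pos (hΔ : G.r ^ 2 < G.Δ) : 0 < G.s₂ := by
  have := G.r_lt_sqrt_Δ hΔ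
  have := G.r_pos
  unfold s₂; linarith

lemma q₂_sub_q₁ : G.q₂ - G.q₁ = 4 * G.b * √G.Δ := by
  unfold q₂ q₁ s₁ s₂; ring

lemma s₁_eq : 3 * G.γ / (4 * G.b) - G.δ + 1 / (4 * G.b) * G.q₁ = G.s₁ := by
  have := G.b_pos.ne'
  unfold q₁; field_simp; ring

lemma s₂_eq : 3 * G.γ / (4 * G.b) - G.δ + 1 / (4 * G.b) * G.q₂ = G.s₂ := by
  have := G.b_pos.ne'
  unfold q₂; field_simp; ring

/-- With `m` the upper left matrix entry, the slopes of the eigenvectors `(1, q)` are the roots of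
`q²/(4b) + (2m - r) q + γ²/(4b)`; this is Vieta's product. -/
lemma q₁_mul_q₂ (hΔ : G.r ^ 2 < G.Δ) : G.q₁ * G.q₂ = G.γ ^ 2 := by
  have hb := G.b_pos.ne'
  have h := G.sq_sqrt_Δ hΔ
  have h1 : G.q₁ * G.q₂ =
      (2 * G.b * (G.r + 2 * G.δ) - 3 * G.γ) ^ 2 - 4 * G.b ^ 2 * √G.Δ ^ 2 := by
    unfold q₁ q₂ s₁ s₂; field_simp; ring
  rw [h1, h]
  unfold Δ; field_simp; ring

/-- The second row of the eigenvector equation follows from the first row for the other eigenvalue,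
through `s₁ + s₂ = r` and `q₁ q₂ = γ²`. -/
lemma s₁_mul_q₁ (hΔ : G.r ^ 2 < G.Δ) :
    -(G.γ ^ 2 / (4 * G.b)) + (G.r + G.δ - 3 * G.γ / (4 * G.b)) * G.q₁ = G.s₁ * G.q₁ := by
  have h : G.r - G.s₁ = G.s₂ := by unfold s₁ s₂; ring
  rw [← G.q₁_mul_q₂ hΔ]
  linear_combination G.q₁ * h - G.q₁ * G.s₂_eq

lemma s₂_mul_q₂ (hΔ : G.r ^ 2 < G.Δ) :
    -(G.γ ^ 2 / (4 * G.b)) + (G.r + G.δ - 3 * G.γ / (4 * G.b)) * G.q₂ = G.s₂ * G.q₂ := by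
  have h : G.r - G.s₁ = G.s₂ := by unfold s₁ s₂; ring
  rw [← G.q₁_mul_q₂ hΔ]
  linear_combination G.q₂ * h - G.q₂ * G.s₁_eq

/-- The hypothesis gives `2b(r + 2δ) > 4γ > 3γ`. Positivity of `q₁` then follows from the product,
and both signs keep the denominator of `lam₀` away from zero. -/
lemma q₂_pos (hΔ : G.r ^ 2 < G.Δ) (hγ : 2 * G.γ < G.b * (G.r + 2 * G.δ)) : 0 < G.q₂ := by
  have hb := G.b_pos
  have h1 : G.q₂ = 2 * G.b * (G.r + 2 * G.δ) - 3 * G.γ + 2 * G.b * √G.Δ := by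
    have := hb.ne'
    unfold q₂ s₂; field_simp; ring
  have := mul_pos hb (G.sqrt_Δ_pos hΔ)
  have := G.γ_pos
  rw [h1]; nlinarith

lemma q₁_pos (hΔ : G.r ^ 2 < G.Δ) (hγ : 2 * G.γ < G.b * (G.r + 2 * G.δ)) : 0 < G.q₁ := by
  have h := G.q₁_mul_q₂ hΔ
  have h2 : 0 < G.γ ^ 2 := pow_pos G.γ_pos 2
  rw [← h] at h2
  exact (pos_iff_pos_of_mul_pos h2).2 (G.q₂_pos hΔ hγ)

lemma lam₀_denominator_ne_zero (hΔ : G.r ^ 2 < G.Δ) (hγ : 2 * G.γ < G.b * (G.r + 2 * G.δ)) :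
    G.q₁ * Real.exp (G.s₁ * G.T) - G.q₂ * Real.exp (G.s₂ * G.T) ≠ 0 := by
  have h1 : G.q₁ < G.q₂ := by
    have := G.q₂_sub_q₁
    have := mul_pos (mul_pos four_pos G.b_pos) (G.sqrt_Δ_pos hΔ)
    linarith
  have h2 : Real.exp (G.s₁ * G.T) < Real.exp (G.s₂ * G.T) := by
    have := G.s₁_neg hΔ
    have := G.s₂_pos hΔ
    have := G.T_pos
    exact Real.exp_lt_exp.2 (mul_lt_mul_of_pos_right (by linarith) this)
  have := mul_lt_mul'' h1 h2 (G.q₁_pos hΔ hγ).le (Real.exp_pos _).le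
  linarith

lemma hasEigenvalue_of_mulVec {M : Matrix (Fin 2) (Fin 2) ℝ} {s q : ℝ}
    (h : M.mulVec ![1, q] = s • ![1, q]) :
    Module.End.HasEigenvalue (Matrix.toLin' M) s := by
  refine Module.End.hasEigenvalue_of_hasEigenvector (x := ![1, q])
    (Module.End.hasEigenvector_iff.2 ⟨Module.End.mem_eigenspace_iff.2 ?_, ?_⟩)
  · rw [Matrix.toLin'_apply, h]
  · intro h0
    simpa using congrFun h0 0

lemma hasEigenvalue_s₁ (hΔ : G.r ^ 2 < G.Δ) :
    Module.End.HasEigenvalue (Matrix.toLin' G.systemMatrix) G.s₁ := by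
  refine hasEigenvalue_of_mulVec (q := G.q₁) ?_
  have h1 := G.s₁_eq
  have h2 := G.s₁_mul_q₁ hΔ
  ext i
  fin_cases i
  · simpa [systemMatrix, Matrix.mulVec, dotProduct, Fin.sum_univ_two] using h1
  · simpa [systemMatrix, Matrix.mulVec, dotProduct, Fin.sum_univ_two] using h2

lemma hasEigenvalue_s₂ (hΔ : G.r ^ 2 < G.Δ) :
    Module.End.HasEigenvalue (Matrix.toLin' G.systemMatrix) G.s₂ := by
  refine hasEigenvalue_of_mulVec (q := G.q₂) ?_
  have h1 := G.s₂_eq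
  have h2 := G.s₂_mul_q₂ hΔ
  ext i
  fin_cases i
  · simpa [systemMatrix, Matrix.mulVec, dotProduct, Fin.sum_univ_two] using h1
  · simpa [systemMatrix, Matrix.mulVec, dotProduct, Fin.sum_univ_two] using h2

/-! ### The explicit solution of the boundary value problem -/

/-- Constant part of `xStar`. -/
noncomputable def x₀ : ℝ :=
  (G.α₁ / (4 * G.b * G.s₂) - G.α₂ / (4 * G.b * G.s₁)) / (4 * G.b * √G.Δ)

lemma E₀_eq : G.E₀ = G.a' + G.c' - G.γ * G.x₀ := rfl

/-- Together with `lamStar_eq` this is the modal form `(x*, λ*) = (x₀, L₀) + Σ Xᵢ e^{sᵢ t} (1, qᵢ)`,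
on which all later computations rest. -/
lemma xStar_eq (t : ℝ) :
    G.xStar t = G.x₀ + G.X₁ * Real.exp (G.s₁ * t) + G.X₂ * Real.exp (G.s₂ * t) := by
  unfold xStar x₀ X₁ X₂; ring

lemma lamStar_eq (t : ℝ) :
    G.lamStar t =
      G.L₀ + G.q₁ * G.X₁ * Real.exp (G.s₁ * t) + G.q₂ * G.X₂ * Real.exp (G.s₂ * t) := by
  unfold lamStar L₀ X₁ X₂; ring

lemma xStar_zero : G.xStar 0 = 0 := by
  simp [xStar]

lemma lamStar_T (hΔ : G.r ^ 2 < G.Δ) (hγ : 2 * G.γ < G.b * (G.r + 2 * G.δ)) :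
    G.lamStar G.T = 0 := by
  have h := G.lam₀_denominator_ne_zero hΔ hγ
  have h1 := (G.s₁_neg hΔ).ne
  have h2 := (G.s₂_pos hΔ).ne'
  have hb := G.b_pos.ne'
  unfold lamStar lam₀
  refine mul_eq_zero_of_right _ ?_
  generalize Real.exp (G.s₁ * G.T) = e₁ at *
  generalize Real.exp (G.s₂ * G.T) = e₂ at *
  field_simp
  ring

/-- The point `(x₀, L₀)` is the rest point of the system, first component. -/
lemma rest_x (hΔ : G.r ^ 2 < G.Δ) :
    (3 * G.γ / (4 * G.b) - G.δ) * G.x₀ + 1 / (4 * G.b) * G.L₀ +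
      (G.a' - 3 * G.c') / (4 * G.b) = 0 := by
  have h1 := (G.s₁_neg hΔ).ne
  have h2 := (G.s₂_pos hΔ).ne'
  have hb := G.b_pos.ne'
  have hσ := (G.sqrt_Δ_pos hΔ).ne'
  -- `(x₀, L₀)` is a combination of the eigenvectors, so the matrix multiplies each part by `sᵢ`,
  -- which cancels the `sᵢ` in its denominator.
  have key : (3 * G.γ / (4 * G.b) - G.δ) * G.x₀ + 1 / (4 * G.b) * G.L₀ =
      (G.s₂ * (G.α₁ / (4 * G.b * G.s₂)) - G.s₁ * (G.α₂ / (4 * G.b * G.s₁))) /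
        (4 * G.b * √G.Δ) := by
    unfold x₀ L₀
    have e1 := G.s₁_eq
    have e2 := G.s₂_eq
    generalize 3 * G.γ / (4 * G.b) - G.δ = m at *
    rw [mul_div_assoc G.q₂, mul_div_assoc G.q₁]
    generalize G.α₁ / (4 * G.b * G.s₂) = B at *
    generalize G.α₂ / (4 * G.b * G.s₁) = C at *
    rw [← e1, ← e2]; ring
  have h3 : G.s₂ * (G.α₁ / (4 * G.b * G.s₂)) - G.s₁ * (G.α₂ / (4 * G.b * G.s₁)) =
      -((G.q₂ - G.q₁) * (G.a' - 3 * G.c')) / (4 * G.b) := by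
    unfold α₁ α₂; field_simp; ring
  rw [key, h3, G.q₂_sub_q₁]
  field_simp
  ring

/-- The point `(x₀, L₀)` is the rest point of the system, second component. -/
lemma rest_lam (hΔ : G.r ^ 2 < G.Δ) :
    -(G.γ ^ 2 / (4 * G.b)) * G.x₀ + (G.r + G.δ - 3 * G.γ / (4 * G.b)) * G.L₀ +
      G.γ * (G.a' + G.c') / (4 * G.b) = 0 := by
  have h1 := (G.s₁_neg hΔ).ne
  have h2 := (G.s₂_pos hΔ).ne'
  have hb := G.b_pos.ne'
  have hσ := (G.sqrt_Δ_pos hΔ).ne'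
  have key : -(G.γ ^ 2 / (4 * G.b)) * G.x₀ + (G.r + G.δ - 3 * G.γ / (4 * G.b)) * G.L₀ =
      (G.q₂ * (G.s₂ * (G.α₁ / (4 * G.b * G.s₂))) - G.q₁ * (G.s₁ * (G.α₂ / (4 * G.b * G.s₁)))) /
        (4 * G.b * √G.Δ) := by
    unfold x₀ L₀
    have e1 := G.s₁_mul_q₁ hΔ
    have e2 := G.s₂_mul_q₂ hΔ
    rw [mul_div_assoc G.q₂, mul_div_assoc G.q₁]
    generalize G.α₁ / (4 * G.b * G.s₂) = B at *
    generalize G.α₂ / (4 * G.b * G.s₁) = C at *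
    generalize 4 * G.b * √G.Δ = D at *
    linear_combination B / D * e2 - C / D * e1
  have h3 : G.q₂ * (G.s₂ * (G.α₁ / (4 * G.b * G.s₂))) -
      G.q₁ * (G.s₁ * (G.α₂ / (4 * G.b * G.s₁))) =
      -((G.q₂ - G.q₁) * (G.γ * (G.a' + G.c'))) / (4 * G.b) := by
    unfold α₁ α₂; field_simp; ring
  rw [key, h3, G.q₂_sub_q₁]
  field_simp
  ring

lemma hasDerivAt_const_mul_exp (X s t : ℝ) :
    HasDerivAt (fun t => X * Real.exp (s * t)) (X * (s * Real.exp (s * t))) t := by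
  have := ((hasDerivAt_id t).const_mul s).exp.const_mul X
  simpa [mul_comm] using this

lemma hasDerivAt_xStar_exp (t : ℝ) :
    HasDerivAt G.xStar
      (G.X₁ * (G.s₁ * Real.exp (G.s₁ * t)) + G.X₂ * (G.s₂ * Real.exp (G.s₂ * t))) t := by
  have := ((hasDerivAt_const_mul_exp G.X₁ G.s₁ t).const_add G.x₀).add
    (hasDerivAt_const_mul_exp G.X₂ G.s₂ t)
  exact this.congr_of_eventuallyEq (Filter.Eventually.of_forall G.xStar_eq)

lemma hasDerivAt_lamStar_exp (t : ℝ) :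
    HasDerivAt G.lamStar
      (G.q₁ * G.X₁ * (G.s₁ * Real.exp (G.s₁ * t)) +
        G.q₂ * G.X₂ * (G.s₂ * Real.exp (G.s₂ * t))) t := by
  have := ((hasDerivAt_const_mul_exp (G.q₁ * G.X₁) G.s₁ t).const_add G.L₀).add
    (hasDerivAt_const_mul_exp (G.q₂ * G.X₂) G.s₂ t)
  exact this.congr_of_eventuallyEq (Filter.Eventually.of_forall G.lamStar_eq)

lemma hasDerivAt_xStar (hΔ : G.r ^ 2 < G.Δ) (t : ℝ) :
    HasDerivAt G.xStar
      ((3 * G.γ / (4 * G.b) - G.δ) * G.xStar t + 1 / (4 * G.b) * G.lamStar t +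
        (G.a' - 3 * G.c') / (4 * G.b)) t := by
  refine (G.hasDerivAt_xStar_exp t).congr_deriv ?_
  rw [G.xStar_eq, G.lamStar_eq]
  linear_combination -G.rest_x hΔ - G.X₁ * Real.exp (G.s₁ * t) * G.s₁_eq -
    G.X₂ * Real.exp (G.s₂ * t) * G.s₂_eq

lemma hasDerivAt_lamStar (hΔ : G.r ^ 2 < G.Δ) (t : ℝ) :
    HasDerivAt G.lamStar
      (-(G.γ ^ 2 / (4 * G.b)) * G.xStar t +
        (G.r + G.δ - 3 * G.γ / (4 * G.b)) * G.lamStar t +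
        G.γ * (G.a' + G.c') / (4 * G.b)) t := by
  refine (G.hasDerivAt_lamStar_exp t).congr_deriv ?_
  rw [G.xStar_eq, G.lamStar_eq]
  linear_combination -G.rest_lam hΔ - G.X₁ * Real.exp (G.s₁ * t) * G.s₁_mul_q₁ hΔ -
    G.X₂ * Real.exp (G.s₂ * t) * G.s₂_mul_q₂ hΔ

lemma solvesBoundaryValueProblem (hΔ : G.r ^ 2 < G.Δ)
    (hγ : 2 * G.γ < G.b * (G.r + 2 * G.δ)) :
    G.SolvesBoundaryValueProblem G.xStar G.lamStar := by
  refine ⟨fun t _ => HasDerivAt.hasDerivWithinAt ?_, G.xStar_zero, G.lamStar_T hΔ hγ⟩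
  rw [hasDerivAt_pi]
  intro i
  fin_cases i
  · refine (G.hasDerivAt_xStar hΔ t).congr_deriv ?_
    simp [systemMatrix, systemForcing]
    ring
  · refine (G.hasDerivAt_lamStar hΔ t).congr_deriv ?_
    simp [systemMatrix, systemForcing]
    ring

lemma continuous_xStar : Continuous G.xStar := by
  unfold xStar; fun_prop

lemma continuous_lamStar : Continuous G.lamStar := by
  unfold lamStar; fun_prop

lemma continuous_u₀Star : Continuous G.u₀Star := by
  have := G.continuous_xStar
  have := G.continuous_lamStar
  unfold u₀Star; fun_prop

lemma continuous_u₁Star : Continuous G.u₁Star := by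
  have := G.continuous_xStar
  have := G.continuous_lamStar
  unfold u₁Star; fun_prop

lemma continuous_u₀Hat : Continuous G.u₀Hat := by
  have := G.continuous_xStar
  have := G.continuous_lamStar
  unfold u₀Hat; fun_prop

lemma hasDerivAt_xStar_u₁Star (hΔ : G.r ^ 2 < G.Δ) (t : ℝ) :
    HasDerivAt G.xStar (G.u₁Star t - G.δ * G.xStar t) t := by
  refine (G.hasDerivAt_xStar hΔ t).congr_deriv ?_
  have := G.b_pos.ne'
  unfold u₁Star; field_simp; ring

lemma isKnowledge_xStar (hΔ : G.r ^ 2 < G.Δ) : G.IsKnowledge G.u₁Star G.xStar := by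
  have h1 := G.continuous_xStar
  have h2 := G.continuous_u₁Star
  refine ⟨h1.continuousOn, fun t _ => ?_⟩
  rw [intervalIntegral.integral_eq_sub_of_hasDerivAt
    (fun s _ => G.hasDerivAt_xStar_u₁Star hΔ s)
    (Continuous.intervalIntegrable (by fun_prop) _ _), G.xStar_zero, sub_zero]

/-! ### Square-integrable functions on an interval -/

lemma memLp_two_of_continuousOn {f : ℝ → ℝ} {A B : ℝ} (hf : ContinuousOn f (Icc A B)) :
    MemLp f 2 (volume.restrict (Icc A B)) := by
  obtain ⟨C, hC⟩ := isCompact_Icc.exists_bound_of_continuousOn hf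
  refine MemLp.of_bound (hf.aestronglyMeasurable measurableSet_Icc) C ?_
  exact (ae_restrict_mem measurableSet_Icc).mono hC

lemma intervalIntegrable_of_memLp_two {f : ℝ → ℝ} {A B : ℝ} (hAB : A ≤ B)
    (hf : MemLp f 2 (volume.restrict (Icc A B))) : IntervalIntegrable f volume A B := by
  rw [intervalIntegrable_iff_integrableOn_Icc_of_le hAB]
  exact hf.integrable one_le_two

lemma intervalIntegrable_exp_mul_mul {f g : ℝ → ℝ} {A B : ℝ} (ρ : ℝ) (hAB : A ≤ B)
    (hf : MemLp f 2 (volume.restrict (Icc A B))) (hg : MemLp g 2 (volume.restrict (Icc A B))) :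
    IntervalIntegrable (fun t => Real.exp (ρ * t) * (f t * g t)) volume A B := by
  refine IntervalIntegrable.continuousOn_mul ?_ (by fun_prop)
  rw [intervalIntegrable_iff_integrableOn_Icc_of_le hAB]
  exact hf.integrable_mul hg

/-! ### Pointwise maximization of a discounted concave quadratic -/

/-- Pointwise, `b w² - (2 b w v - b v²) = b (v - w)²`. This serves both the follower's reply and the
leader's defection, with `w` the pointwise maximizer. -/
lemma integral_quadratic_gap {v w : ℝ → ℝ} {A B : ℝ} (ρ b : ℝ) (hAB : A ≤ B)
    (hv : MemLp v 2 (volume.restrict (Icc A B))) (hw : MemLp w 2 (volume.restrict (Icc A B))) :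
    (∫ t in A..B, Real.exp (ρ * t) * (w t * (2 * b * w t - b * w t))) -
        ∫ t in A..B, Real.exp (ρ * t) * (v t * (2 * b * w t - b * v t)) =
      b * ∫ t in A..B, Real.exp (ρ * t) * ((v t - w t) * (v t - w t)) := by
  have i1 := intervalIntegrable_exp_mul_mul ρ hAB hw
    ((hw.const_mul (2 * b)).sub (hw.const_mul b))
  have i2 := intervalIntegrable_exp_mul_mul ρ hAB hv
    ((hw.const_mul (2 * b)).sub (hv.const_mul b))
  simp only [Pi.sub_apply] at i1 i2
  rw [← intervalIntegral.integral_sub i1 i2, ← intervalIntegral.integral_const_mul]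
  congr 1
  ext t
  ring

lemma integral_exp_mul_sq_nonneg {f : ℝ → ℝ} {A B : ℝ} (ρ : ℝ) (hAB : A ≤ B) :
    0 ≤ ∫ t in A..B, Real.exp (ρ * t) * (f t * f t) :=
  intervalIntegral.integral_nonneg hAB fun _ _ =>
    mul_nonneg (Real.exp_pos _).le (mul_self_nonneg _)

lemma integral_quadratic_le {v w : ℝ → ℝ} {A B ρ b : ℝ} (hb : 0 ≤ b) (hAB : A ≤ B)
    (hv : MemLp v 2 (volume.restrict (Icc A B))) (hw : MemLp w 2 (volume.restrict (Icc A B))) :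
    (∫ t in A..B, Real.exp (ρ * t) * (v t * (2 * b * w t - b * v t))) ≤
      ∫ t in A..B, Real.exp (ρ * t) * (w t * (2 * b * w t - b * w t)) := by
  have h := integral_quadratic_gap ρ b hAB hv hw
  have := mul_nonneg hb (integral_exp_mul_sq_nonneg (f := fun t => v t - w t) ρ hAB)
  linarith

lemma ae_eq_of_integral_quadratic_le {v w : ℝ → ℝ} {A B ρ b : ℝ} (hb : 0 < b) (hAB : A ≤ B)
    (hv : MemLp v 2 (volume.restrict (Icc A B))) (hw : MemLp w 2 (volume.restrict (Icc A B)))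
    (hle : (∫ t in A..B, Real.exp (ρ * t) * (w t * (2 * b * w t - b * w t))) ≤
      ∫ t in A..B, Real.exp (ρ * t) * (v t * (2 * b * w t - b * v t))) :
    ∀ᵐ t, t ∈ Ioc A B → v t = w t := by
  have h := integral_quadratic_gap ρ b hAB hv hw
  have h0 := integral_exp_mul_sq_nonneg (f := fun t => v t - w t) ρ hAB
  have h1 : ∫ t in A..B, Real.exp (ρ * t) * ((v t - w t) * (v t - w t)) = 0 := by
    refine le_antisymm ?_ h0
    by_contra hc
    have := mul_pos hb (not_le.1 hc)
    linarith
  have i1 := intervalIntegrable_exp_mul_mul ρ hAB (hv.sub hw) (hv.sub hw)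
  simp only [Pi.sub_apply] at i1
  rw [intervalIntegral.integral_eq_zero_iff_of_le_of_nonneg_ae hAB
    (Filter.Eventually.of_forall fun _ => mul_nonneg (Real.exp_pos _).le (mul_self_nonneg _))
    i1] at h1
  filter_upwards [(ae_restrict_iff' measurableSet_Ioc).1 h1] with t ht htm
  have := ht htm
  simp only [Pi.zero_apply, mul_eq_zero, (Real.exp_pos _).ne', false_or, or_self] at this
  linarith

/-! ### The second-order condition of the leader's problem -/

variable (G : Duopoly)

/-- Growth rate of deviations of the knowledge stock under the follower's reply. -/
noncomputable def κ : ℝ := G.γ / (2 * G.b) - G.δ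

/-- The adjoint equation in the form dual to `y' = κ y - h/2`: in the derivative of `e^{-rt} λ* y`
the terms in `λ* y` cancel. -/
lemma hasDerivAt_lamStar_u₀Star (hΔ : G.r ^ 2 < G.Δ) (t : ℝ) :
    HasDerivAt G.lamStar ((G.r - G.κ) * G.lamStar t + G.γ * G.u₀Star t / 2) t := by
  refine (G.hasDerivAt_lamStar hΔ t).congr_deriv ?_
  have := G.b_pos.ne'
  unfold u₀Star κ; field_simp; ring

lemma contDiff_lamStar : ContDiff ℝ 1 G.lamStar := by
  unfold lamStar; fun_prop

/-- The integrand is the derivative of `-e^{-rt}(2 λ* y + γ y²)`; at the ends `y A = 0` and `λ*(T) =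
0` leave only the term in `y(T)²`. Among weights `p` in place of `γ`, `p = γ` minimizes `(γ +
p)²/p`, hence suits best the completion of the square in `integral_deviation`. -/
lemma integral_total_derivative (hΔ : G.r ^ 2 < G.Δ) (hγ : 2 * G.γ < G.b * (G.r + 2 * G.δ))
    {A : ℝ} (hA : A ≤ G.T) {h y : ℝ → ℝ} (hh : IntervalIntegrable h volume A G.T)
    (hyc : ContinuousOn y (Icc A G.T))
    (hy : ∀ t ∈ Icc A G.T, y t = ∫ s in A..t, (G.κ * y s - h s / 2)) :
    ∫ t in A..G.T, Real.exp (-G.r * t) *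
        (G.lamStar t * h t - G.γ * G.u₀Star t * y t + G.γ * h t * y t +
          G.γ * (G.r - 2 * G.κ) * y t ^ 2) =
      -(G.γ * Real.exp (-G.r * G.T) * y G.T ^ 2) := by
  have hg : IntervalIntegrable (fun s => G.κ * y s - h s / 2) volume A G.T := by
    refine IntervalIntegrable.sub ?_ (hh.div_const 2)
    exact (ContinuousOn.intervalIntegrable (by rwa [uIcc_of_le hA])).const_mul _
  set Y : ℝ → ℝ := fun t => ∫ s in A..t, (G.κ * y s - h s / 2) with hYdef
  -- As `h` is merely integrable, `y` is differentiable only almost everywhere, and the fundamental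
  -- theorem is needed for absolutely continuous functions.
  have hYac : AbsolutelyContinuousOnInterval Y A G.T :=
    hg.absolutelyContinuousOnInterval_intervalIntegral left_mem_uIcc
  have hlam := G.contDiff_lamStar
  have h1 : AbsolutelyContinuousOnInterval
      (fun t => -(2 * Real.exp (-G.r * t) * G.lamStar t)) A G.T :=
    ContDiffOn.absolutelyContinuousOnInterval (ContDiff.contDiffOn (by fun_prop))
  have h2 : AbsolutelyContinuousOnInterval
      (fun t => -(G.γ * Real.exp (-G.r * t))) A G.T :=
    ContDiffOn.absolutelyContinuousOnInterval (ContDiff.contDiffOn (by fun_prop))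
  have hF := (h1.fun_mul hYac).fun_add (h2.fun_mul (hYac.fun_mul hYac))
  have hint := hF.integral_deriv_eq_sub
  have hYA : Y A = 0 := intervalIntegral.integral_same
  have hYT : Y G.T = y G.T := (hy G.T (right_mem_Icc.2 hA)).symm
  rw [hYA, hYT, G.lamStar_T hΔ hγ] at hint
  refine Eq.trans ?_ (hint.trans (by ring))
  refine intervalIntegral.integral_congr_ae ?_
  filter_upwards [hg.ae_hasDerivAt_integral] with t ht htm
  have htI : t ∈ uIcc A G.T := uIoc_subset_uIcc htm
  have hYt : HasDerivAt Y (G.κ * y t - h t / 2) t := ht htI A left_mem_uIcc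
  have hyt : y t = Y t := hy t (by rwa [uIcc_of_le hA] at htI)
  have hexp : HasDerivAt (fun t => Real.exp (-G.r * t)) (-G.r * Real.exp (-G.r * t)) t := by
    simpa using hasDerivAt_const_mul_exp 1 (-G.r) t
  have hl := G.hasDerivAt_lamStar_u₀Star hΔ t
  have hd := ((((hexp.const_mul 2).mul hl).neg).mul hYt).add
    (((hexp.const_mul G.γ).neg).mul (hYt.mul hYt))
  refine Eq.trans ?_ hd.deriv.symm
  simp only [Pi.mul_apply, Pi.neg_apply]
  rw [hyt]
  ring

/-- The effect on the leader's payoff (doubled) of a deviation `h` of his control that moves the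
knowledge stock by `y`, as minus a sum of squares. -/
lemma integral_deviation (hΔ : G.r ^ 2 < G.Δ) (hγ : 2 * G.γ < G.b * (G.r + 2 * G.δ))
    {A : ℝ} (hA : A ≤ G.T) {h y : ℝ → ℝ} (hh : MemLp h 2 (volume.restrict (Icc A G.T)))
    (hyc : ContinuousOn y (Icc A G.T))
    (hy : ∀ t ∈ Icc A G.T, y t = ∫ s in A..t, (G.κ * y s - h s / 2)) :
    ∫ t in A..G.T, Real.exp (-G.r * t) *
        (G.lamStar t * h t - G.γ * G.u₀Star t * y t - G.b * h t ^ 2 - G.γ * h t * y t) =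
      -(G.γ * Real.exp (-G.r * G.T) * y G.T ^ 2) -
        (∫ t in A..G.T, Real.exp (-G.r * t) *
          (G.b * (h t + G.γ / G.b * y t) ^ 2 +
            G.γ * (G.r + 2 * G.δ - 2 * G.γ / G.b) * y t ^ 2)) := by
  have hb := G.b_pos.ne'
  have hyL := memLp_two_of_continuousOn hyc
  have hlL : MemLp G.lamStar 2 (volume.restrict (Icc A G.T)) :=
    memLp_two_of_continuousOn G.continuous_lamStar.continuousOn
  have huL : MemLp G.u₀Star 2 (volume.restrict (Icc A G.T)) :=
    memLp_two_of_continuousOn G.continuous_u₀Star.continuousOn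
  rw [← G.integral_total_derivative hΔ hγ hA (intervalIntegrable_of_memLp_two hA hh) hyc hy,
    ← intervalIntegral.integral_sub]
  -- The difference is `-b h² - 2γ h y - γ(r - 2κ) y²`, where `r - 2κ = r + 2δ - γ/b`; completing
  -- the square costs a further `γ/b`.
  · refine intervalIntegral.integral_congr fun t _ => ?_
    unfold κ
    field_simp
    ring
  · have i1 := intervalIntegrable_exp_mul_mul (-G.r) hA hlL hh
    have i2 := intervalIntegrable_exp_mul_mul (-G.r) hA (huL.const_mul G.γ) hyL
    have i3 := intervalIntegrable_exp_mul_mul (-G.r) hA (hh.const_mul G.γ) hyL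
    have i4 := intervalIntegrable_exp_mul_mul (-G.r) hA
      (hyL.const_mul (G.γ * (G.r - 2 * G.κ))) hyL
    refine (((i1.sub i2).add i3).add i4).congr fun t _ => ?_
    ring
  · have hz := hh.add (hyL.const_mul (G.γ / G.b))
    have i1 := intervalIntegrable_exp_mul_mul (-G.r) hA (hz.const_mul G.b) hz
    have i2 := intervalIntegrable_exp_mul_mul (-G.r) hA
      (hyL.const_mul (G.γ * (G.r + 2 * G.δ - 2 * G.γ / G.b))) hyL
    refine (i1.add i2).congr fun t _ => ?_
    simp only [Pi.add_apply]
    ring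

lemma curvature_pos (hγ : 2 * G.γ < G.b * (G.r + 2 * G.δ)) :
    0 < G.γ * (G.r + 2 * G.δ - 2 * G.γ / G.b) := by
  refine mul_pos G.γ_pos (sub_pos.2 ?_)
  rw [div_lt_iff₀ G.b_pos]
  linarith

/-! ### Best replies -/

/-- The myopic reply of the follower to the output `u` at knowledge stock `x`. -/
noncomputable def reply (u x : ℝ) : ℝ := (G.a - G.b * u - G.followerCost x) / (2 * G.b)

lemma followerPayoff_eq (u₀ x v : ℝ → ℝ) :
    G.followerPayoff (fun t => G.followerCost (x t)) u₀ v =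
      ∫ t in (0 : ℝ)..G.T, Real.exp (-G.r * t) *
        (v t * (2 * G.b * G.reply (u₀ t) (x t) - G.b * v t)) := by
  have := G.b_pos.ne'
  refine intervalIntegral.integral_congr fun t _ => ?_
  simp only [reply]
  field_simp
  ring

lemma memLp_reply {u₀ x : ℝ → ℝ} (hu₀ : G.Admissible u₀) (hx : ContinuousOn x (Icc 0 G.T)) :
    MemLp (fun t => G.reply (u₀ t) (x t)) 2 (volume.restrict (Icc 0 G.T)) := by
  have h1 : MemLp (fun t => (G.a - G.followerCost (x t)) / (2 * G.b)) 2
      (volume.restrict (Icc 0 G.T)) :=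
    memLp_two_of_continuousOn (by unfold followerCost; fun_prop)
  have h2 := MemLp.sub h1 (MemLp.const_mul hu₀ (1 / 2))
  refine h2.ae_eq (Filter.Eventually.of_forall fun t => ?_)
  have := G.b_pos.ne'
  simp only [reply, Pi.sub_apply]
  field_simp
  ring

/-- The pointwise reply to the stock generated by `u₁` is itself an admissible competitor; testing
maximality against it forces equality almost everywhere. -/
lemma IsBestReply.exists_ae_eq_reply {G : Duopoly} {u₀ u₁ : ℝ → ℝ} (hu₀ : G.Admissible u₀)
    (h : G.IsBestReply u₀ u₁) :
    ∃ x, G.IsKnowledge u₁ x ∧ ∀ᵐ t, t ∈ Ioc 0 G.T → u₁ t = G.reply (u₀ t) (x t) := by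
  obtain ⟨hu₁, x, hx, hmax⟩ := h
  have hw := G.memLp_reply hu₀ hx.1
  have hle := hmax _ hw
  rw [G.followerPayoff_eq, G.followerPayoff_eq] at hle
  exact ⟨x, hx, ae_eq_of_integral_quadratic_le G.b_pos G.T_pos.le hu₁ hw hle⟩

lemma isBestReply_of_eq_reply {u₀ u₁ x : ℝ → ℝ} (hu₀ : G.Admissible u₀)
    (hx : G.IsKnowledge u₁ x) (h : ∀ t, u₁ t = G.reply (u₀ t) (x t)) :
    G.IsBestReply u₀ u₁ := by
  have hw := G.memLp_reply hu₀ hx.1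
  obtain rfl : u₁ = fun t => G.reply (u₀ t) (x t) := funext h
  refine ⟨hw, x, hx, fun v hv => ?_⟩
  rw [G.followerPayoff_eq, G.followerPayoff_eq]
  exact integral_quadratic_le G.b_pos.le G.T_pos.le hv hw

lemma u₁Star_eq_reply (t : ℝ) : G.u₁Star t = G.reply (G.u₀Star t) (G.xStar t) := by
  have := G.b_pos.ne'
  unfold u₁Star reply u₀Star followerCost a' c'
  field_simp
  ring

lemma admissible_of_continuous {u : ℝ → ℝ} (hu : Continuous u) : G.Admissible u :=
  memLp_two_of_continuousOn hu.continuousOn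

/-! ### The leader's problem -/

/-- Profit of the leader when the follower replies myopically. -/
lemma leaderProfit_reply (u x : ℝ) :
    G.leaderProfit u (G.reply u x) = u * (G.a' + G.c' - G.γ * x - G.b * u) / 2 := by
  have := G.b_pos.ne'
  unfold leaderProfit reply followerCost a' c'
  field_simp
  ring

/-- Exact second-order expansion at the equilibrium; `λ*` is the marginal value of `u`, by the
definition of `u₀Star`. -/
lemma leaderProfit_reply_sub (t u x : ℝ) :
    2 * (G.leaderProfit u (G.reply u x) - G.leaderProfit (G.u₀Star t) (G.u₁Star t)) =
      G.lamStar t * (u - G.u₀Star t) - G.γ * G.u₀Star t * (x - G.xStar t) -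
        G.b * (u - G.u₀Star t) ^ 2 - G.γ * (u - G.u₀Star t) * (x - G.xStar t) := by
  have hl : G.lamStar t = G.a' + G.c' - G.γ * G.xStar t - 2 * G.b * G.u₀Star t := by
    have := G.b_pos.ne'
    unfold u₀Star
    field_simp
    ring
  rw [G.u₁Star_eq_reply, G.leaderProfit_reply, G.leaderProfit_reply, hl]
  ring

lemma knowledge_sub_eq_integral (hΔ : G.r ^ 2 < G.Δ) {v₀ v₁ x : ℝ → ℝ} (hv₁ : G.Admissible v₁)
    (hx : G.IsKnowledge v₁ x) (hv : ∀ᵐ t, t ∈ Ioc 0 G.T → v₁ t = G.reply (v₀ t) (x t)) :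
    ∀ t ∈ Icc 0 G.T, x t - G.xStar t =
      ∫ s in (0 : ℝ)..t, (G.κ * (x s - G.xStar s) - (v₀ s - G.u₀Star s) / 2) := by
  intro t ht
  have hsub : uIcc 0 t ⊆ uIcc 0 G.T := by
    rw [uIcc_of_le ht.1, uIcc_of_le G.T_pos.le]
    exact Icc_subset_Icc_right ht.2
  have i1 : IntervalIntegrable (fun s => v₁ s - G.δ * x s) volume 0 t := by
    refine IntervalIntegrable.mono_set ?_ hsub
    refine (intervalIntegrable_of_memLp_two G.T_pos.le hv₁).sub ?_
    refine (ContinuousOn.intervalIntegrable ?_).const_mul _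
    rw [uIcc_of_le G.T_pos.le]
    exact hx.1
  have i2 : IntervalIntegrable (fun s => G.u₁Star s - G.δ * G.xStar s) volume 0 t := by
    have h1 := G.continuous_xStar
    have h2 := G.continuous_u₁Star
    exact Continuous.intervalIntegrable (by fun_prop) _ _
  rw [hx.2 t ht, (G.isKnowledge_xStar hΔ).2 t ht, ← intervalIntegral.integral_sub i1 i2]
  refine intervalIntegral.integral_congr_ae ?_
  filter_upwards [hv] with s hs hst
  rw [uIoc_of_le ht.1] at hst
  rw [hs ⟨hst.1, hst.2.trans ht.2⟩, G.u₁Star_eq_reply]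
  have := G.b_pos.ne'
  unfold reply κ followerCost
  field_simp
  ring

lemma intervalIntegrable_leaderProfit {w₀ w₁ : ℝ → ℝ} (h₀ : G.Admissible w₀)
    (h₁ : G.Admissible w₁) :
    IntervalIntegrable (fun t => Real.exp (-G.r * t) * G.leaderProfit (w₀ t) (w₁ t))
      volume 0 G.T := by
  have hc : MemLp (fun _ : ℝ => G.a - G.c₀) 2 (volume.restrict (Icc 0 G.T)) :=
    memLp_two_of_continuousOn continuousOn_const
  have h2 : MemLp (fun t => G.b * (w₁ t + w₀ t)) 2 (volume.restrict (Icc 0 G.T)) :=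
    (MemLp.add h₁ h₀).const_mul G.b
  have h3 := intervalIntegrable_exp_mul_mul (-G.r) G.T_pos.le h₀ (hc.sub h2)
  refine h3.congr fun t _ => ?_
  simp only [leaderProfit, Pi.sub_apply]
  ring

lemma leaderPayoff_le (hΔ : G.r ^ 2 < G.Δ) (hγ : 2 * G.γ < G.b * (G.r + 2 * G.δ))
    {v₀ v₁ : ℝ → ℝ} (hv₀ : G.Admissible v₀) (hbr : G.IsBestReply v₀ v₁) :
    G.leaderPayoff v₀ v₁ ≤ G.leaderPayoff G.u₀Star G.u₁Star := by
  obtain ⟨x, hx, hv⟩ := hbr.exists_ae_eq_reply hv₀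
  have hv₁ := hbr.1
  have hT := G.T_pos.le
  have hu₀ := G.admissible_of_continuous G.continuous_u₀Star
  have hu₁ := G.admissible_of_continuous G.continuous_u₁Star
  have hgap : 2 * (G.leaderPayoff v₀ v₁ - G.leaderPayoff G.u₀Star G.u₁Star) =
      ∫ t in (0 : ℝ)..G.T, Real.exp (-G.r * t) *
        (G.lamStar t * (v₀ t - G.u₀Star t) - G.γ * G.u₀Star t * (x t - G.xStar t) -
        G.b * (v₀ t - G.u₀Star t) ^ 2 - G.γ * (v₀ t - G.u₀Star t) * (x t - G.xStar t)) := by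
    unfold leaderPayoff
    rw [← intervalIntegral.integral_sub (G.intervalIntegrable_leaderProfit hv₀ hv₁)
      (G.intervalIntegrable_leaderProfit hu₀ hu₁),
      ← intervalIntegral.integral_const_mul]
    refine intervalIntegral.integral_congr_ae ?_
    filter_upwards [hv] with t ht htm
    rw [uIoc_of_le hT] at htm
    rw [ht htm, ← G.leaderProfit_reply_sub]
    ring
  have hx' := G.continuous_xStar
  rw [G.integral_deviation hΔ hγ hT (h := fun t => v₀ t - G.u₀Star t)
    (y := fun t => x t - G.xStar t) (MemLp.sub hv₀ hu₀) (hx.1.sub hx'.continuousOn)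
    (G.knowledge_sub_eq_integral hΔ hv₁ hx hv)] at hgap
  have h1 : 0 ≤ G.γ * Real.exp (-G.r * G.T) * (x G.T - G.xStar G.T) ^ 2 :=
    mul_nonneg (mul_nonneg G.γ_pos.le (Real.exp_pos _).le) (sq_nonneg _)
  have h2 : 0 ≤ ∫ t in (0 : ℝ)..G.T, Real.exp (-G.r * t) *
          (G.b * ((v₀ t - G.u₀Star t) + G.γ / G.b * (x t - G.xStar t)) ^ 2 +
            G.γ * (G.r + 2 * G.δ - 2 * G.γ / G.b) * (x t - G.xStar t) ^ 2) := by
    refine intervalIntegral.integral_nonneg hT fun t _ => mul_nonneg (Real.exp_pos _).le ?_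
    exact add_nonneg (mul_nonneg G.b_pos.le (sq_nonneg _))
      (mul_nonneg (G.curvature_pos hγ).le (sq_nonneg _))
  linarith

lemma isStackelbergEquilibrium (hΔ : G.r ^ 2 < G.Δ) (hγ : 2 * G.γ < G.b * (G.r + 2 * G.δ)) :
    G.IsStackelbergEquilibrium G.u₀Star G.u₁Star := by
  have hu₀ := G.admissible_of_continuous G.continuous_u₀Star
  exact ⟨hu₀, G.isBestReply_of_eq_reply hu₀ (G.isKnowledge_xStar hΔ) G.u₁Star_eq_reply,
    fun _ _ hv₀ hbr => G.leaderPayoff_le hΔ hγ hv₀ hbr⟩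

/-! ### Optimal defection -/

/-- Against the fixed `u₁Star` the leader's margin before his own output is `2 b û₀`, which brings
the profit to the form of `integral_quadratic_le`. -/
lemma leaderProfit_eq_u₀Hat (v t : ℝ) :
    G.leaderProfit v (G.u₁Star t) = v * (2 * G.b * G.u₀Hat t - G.b * v) := by
  have := G.b_pos.ne'
  unfold leaderProfit u₁Star u₀Hat a' c'
  field_simp
  ring

lemma isOptimalDefection {t₀ : ℝ} (ht₀ : 0 ≤ t₀) (ht₀T : t₀ ≤ G.T) :
    G.IsOptimalDefection t₀ G.u₁Star G.u₀Hat := by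
  refine ⟨G.admissible_of_continuous G.continuous_u₀Hat, fun v hv => ?_⟩
  simp only [G.leaderProfit_eq_u₀Hat]
  exact integral_quadratic_le G.b_pos.le ht₀T
    (hv.mono_measure (Measure.restrict_mono (Icc_subset_Icc_left ht₀) le_rfl))
    (memLp_two_of_continuousOn G.continuous_u₀Hat.continuousOn)

/-! ### The condition on the penalty rate -/

/-- The case `z = 0` is not exceptional: `s₁ + s₂ - r = 0` always, so the quotient multiplying `A₅`
is always read as its limit. -/
lemma integral_exp_mul_eq_expQuot (z A B : ℝ) :
    ∫ t in A..B, Real.exp (z * t) = Real.exp (z * A) * expQuot z (B - A) := by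
  unfold expQuot
  split_ifs with hz
  · simp [hz]
  · have h1 : ∀ t ∈ uIcc A B,
        HasDerivAt (fun t => Real.exp (z * t) / z) (Real.exp (z * t)) t := by
      intro t _
      refine ((hasDerivAt_const_mul_exp 1 z t).div_const z).congr_deriv ?_ |>.congr_of_eventuallyEq
        (Filter.Eventually.of_forall fun t => by simp)
      field_simp
    rw [intervalIntegral.integral_eq_sub_of_hasDerivAt h1
      (Continuous.intervalIntegrable (by fun_prop) _ _)]
    have h2 : Real.exp (z * B) = Real.exp (z * A) * Real.exp (z * (B - A)) := by
      rw [← Real.exp_add]; ring_nf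
    rw [h2]
    ring

/-- Integral of the square of an exponential polynomial with exponents `s`, `s'`, `0`, expanded,
against `e^{ρ t}`. -/
lemma integral_exp_mul_exp_polynomial (ρ s s' A B c₁ c₂ c₃ c₄ c₅ c₆ : ℝ) :
    ∫ t in A..B, Real.exp (ρ * t) *
        (c₁ * Real.exp (s * t) + c₂ * Real.exp (s' * t) + c₃ * Real.exp (s * t) ^ 2 +
          c₄ * Real.exp (s' * t) ^ 2 + c₅ * (Real.exp (s * t) * Real.exp (s' * t)) + c₆) =
      c₁ * (Real.exp ((s + ρ) * A) * expQuot (s + ρ) (B - A)) +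
      c₂ * (Real.exp ((s' + ρ) * A) * expQuot (s' + ρ) (B - A)) +
      c₃ * (Real.exp ((2 * s + ρ) * A) * expQuot (2 * s + ρ) (B - A)) +
      c₄ * (Real.exp ((2 * s' + ρ) * A) * expQuot (2 * s' + ρ) (B - A)) +
      c₅ * (Real.exp ((s + s' + ρ) * A) * expQuot (s + s' + ρ) (B - A)) +
      c₆ * (Real.exp (ρ * A) * expQuot ρ (B - A)) := by
  have hi : ∀ c z : ℝ, IntervalIntegrable (fun t => c * Real.exp (z * t)) volume A B :=
    fun c z => Continuous.intervalIntegrable (by fun_prop) _ _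
  simp only [← integral_exp_mul_eq_expQuot, ← intervalIntegral.integral_const_mul]
  rw [← intervalIntegral.integral_add (hi _ _) (hi _ _),
    ← intervalIntegral.integral_add ((hi _ _).add (hi _ _)) (hi _ _),
    ← intervalIntegral.integral_add (((hi _ _).add (hi _ _)).add (hi _ _)) (hi _ _),
    ← intervalIntegral.integral_add ((((hi _ _).add (hi _ _)).add (hi _ _)).add (hi _ _))
      (hi _ _),
    ← intervalIntegral.integral_add
      (((((hi _ _).add (hi _ _)).add (hi _ _)).add (hi _ _)).add (hi _ _)) (hi _ _)]
  refine intervalIntegral.integral_congr fun t _ => ?_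
  simp only [add_mul, two_mul, Real.exp_add]
  ring

lemma leaderProfit_star (t : ℝ) :
    64 * G.b * G.leaderProfit (G.u₀Star t) (G.u₁Star t) =
      8 * ((G.a' + G.c' - G.γ * G.xStar t) ^ 2 - G.lamStar t ^ 2) := by
  have := G.b_pos.ne'
  rw [G.u₁Star_eq_reply, G.leaderProfit_reply]
  unfold u₀Star
  field_simp
  ring

lemma leaderProfit_hat (t : ℝ) :
    64 * G.b * G.leaderProfit (G.u₀Hat t) (G.u₁Star t) =
      (3 * (G.a' + G.c' - G.γ * G.xStar t) - G.lamStar t) ^ 2 := by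
  have := G.b_pos.ne'
  rw [G.leaderProfit_eq_u₀Hat]
  unfold u₀Hat
  field_simp
  ring

lemma integral_leaderProfit_star (t₀ : ℝ) :
    64 * G.b * ∫ t in t₀..G.T, Real.exp (-G.r * t) * G.leaderProfit (G.u₀Star t) (G.u₁Star t) =
      G.A₁ t₀ * expQuot (G.s₁ - G.r) (G.T - t₀) +
      G.A₂ t₀ * expQuot (G.s₂ - G.r) (G.T - t₀) +
      G.A₃ t₀ * expQuot (2 * G.s₁ - G.r) (G.T - t₀) +
      G.A₄ t₀ * expQuot (2 * G.s₂ - G.r) (G.T - t₀) +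
      G.A₅ t₀ * expQuot (G.s₁ + G.s₂ - G.r) (G.T - t₀) -
      G.A₆ t₀ * (Real.exp (-G.r * (G.T - t₀)) - 1) / G.r := by
  have h := integral_exp_mul_exp_polynomial (-G.r) G.s₁ G.s₂ t₀ G.T
    (-(16 * G.X₁ * (G.γ * G.E₀ + G.q₁ * G.L₀))) (-(16 * G.X₂ * (G.γ * G.E₀ + G.q₂ * G.L₀)))
    (8 * G.X₁ ^ 2 * (G.γ ^ 2 - G.q₁ ^ 2)) (8 * G.X₂ ^ 2 * (G.γ ^ 2 - G.q₂ ^ 2))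
    (16 * G.X₁ * G.X₂ * (G.γ ^ 2 - G.q₁ * G.q₂)) (8 * (G.E₀ ^ 2 - G.L₀ ^ 2))
  have hr : expQuot (-G.r) (G.T - t₀) = -((Real.exp (-G.r * (G.T - t₀)) - 1) / G.r) := by
    rw [expQuot, if_neg (neg_ne_zero.2 G.r_pos.ne'), div_neg]
  rw [hr] at h
  simp only [← sub_eq_add_neg] at h
  rw [← intervalIntegral.integral_const_mul]
  calc _ = _ := intervalIntegral.integral_congr fun t _ => ?_
    _ = _ := h
    _ = _ := by unfold A₁ A₂ A₃ A₄ A₅ A₆; ring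
  have hp := G.leaderProfit_star t
  rw [G.xStar_eq, G.lamStar_eq] at hp
  simp only [G.E₀_eq]
  linear_combination Real.exp (-G.r * t) * hp

lemma integral_leaderProfit_hat (t₀ : ℝ) {k : ℝ} (hk : 0 < k) :
    -(64 * G.b * ∫ t in t₀..G.T, Real.exp (-G.r * t) * Real.exp (-k * (t - t₀)) *
        G.leaderProfit (G.u₀Hat t) (G.u₁Star t)) =
      G.A₇ t₀ * expQuot (G.s₁ - k - G.r) (G.T - t₀) +
      G.A₈ t₀ * expQuot (G.s₂ - k - G.r) (G.T - t₀) +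
      G.A₉ t₀ * expQuot (2 * G.s₁ - k - G.r) (G.T - t₀) +
      G.A₁₀ t₀ * expQuot (2 * G.s₂ - k - G.r) (G.T - t₀) +
      G.A₁₁ t₀ * expQuot (G.s₁ + G.s₂ - k - G.r) (G.T - t₀) -
      G.A₁₂ t₀ * (Real.exp (-(k + G.r) * (G.T - t₀)) - 1) / (k + G.r) := by
  have h := integral_exp_mul_exp_polynomial (-(k + G.r)) G.s₁ G.s₂ t₀ G.T
    (2 * G.X₁ * (3 * G.γ + G.q₁) * (3 * G.E₀ - G.L₀))
    (2 * G.X₂ * (3 * G.γ + G.q₂) * (3 * G.E₀ - G.L₀))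
    (-(G.X₁ ^ 2 * (3 * G.γ + G.q₁) ^ 2)) (-(G.X₂ ^ 2 * (3 * G.γ + G.q₂) ^ 2))
    (-(2 * G.X₁ * G.X₂ * (3 * G.γ + G.q₁) * (3 * G.γ + G.q₂))) (-(3 * G.E₀ - G.L₀) ^ 2)
  have hr : expQuot (-(k + G.r)) (G.T - t₀) =
      -((Real.exp (-(k + G.r) * (G.T - t₀)) - 1) / (k + G.r)) := by
    rw [expQuot, if_neg (neg_ne_zero.2 (add_pos hk G.r_pos).ne'), div_neg]
  have hz : ∀ z : ℝ, z + -(k + G.r) = z - k - G.r := fun z => by ring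
  have he : ∀ z : ℝ, Real.exp ((z - k - G.r) * t₀) =
      Real.exp (-(k * t₀)) * Real.exp ((z - G.r) * t₀) := fun z => by
    rw [← Real.exp_add]; ring_nf
  have he0 : Real.exp (-(k + G.r) * t₀) = Real.exp (-(k * t₀)) * Real.exp (-G.r * t₀) := by
    rw [← Real.exp_add]; ring_nf
  have hk1 : Real.exp (k * t₀) * Real.exp (-(k * t₀)) = 1 := by
    rw [← Real.exp_add]; simp
  rw [hr] at h
  simp only [hz, he, he0] at h
  rw [← intervalIntegral.integral_const_mul, ← intervalIntegral.integral_neg]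
  calc _ = _ := intervalIntegral.integral_congr fun t _ => ?_
    -- The penalty is counted from `t₀`, so the factor `e^{k t₀}` cancels the `e^{-k t₀}` from the
    -- lower limit; hence `k` does not enter the coefficients `Aᵢ`.
    _ = Real.exp (k * t₀) * _ := intervalIntegral.integral_const_mul _ _
    _ = Real.exp (k * t₀) * _ := by rw [h]
    _ = (Real.exp (k * t₀) * Real.exp (-(k * t₀))) * _ := ?_
    _ = _ := by rw [hk1, one_mul]
  · have hp := G.leaderProfit_hat t
    rw [G.xStar_eq, G.lamStar_eq] at hp
    have hek : Real.exp (-G.r * t) * Real.exp (-k * (t - t₀)) =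
        Real.exp (k * t₀) * Real.exp (-(k + G.r) * t) := by
      rw [← Real.exp_add, ← Real.exp_add]; ring_nf
    simp only [G.E₀_eq, hek]
    linear_combination -(Real.exp (k * t₀) * Real.exp (-(k + G.r) * t)) * hp
  · unfold A₇ A₈ A₉ A₁₀ A₁₁ A₁₂
    ring

lemma continuous_leaderProfit {u v : ℝ → ℝ} (hu : Continuous u) (hv : Continuous v) :
    Continuous fun t => G.leaderProfit (u t) (v t) := by
  unfold leaderProfit; fun_prop

lemma leaderPayoff_sub_defectionPayoff {t₀ k : ℝ} (ht₀T : t₀ ≤ G.T) :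
    G.leaderPayoff G.u₀Star G.u₁Star - G.defectionPayoff t₀ k G.u₀Star G.u₁Star G.u₀Hat =
      (∫ t in t₀..G.T, Real.exp (-G.r * t) * G.leaderProfit (G.u₀Star t) (G.u₁Star t)) -
        ∫ t in t₀..G.T, Real.exp (-G.r * t) * Real.exp (-k * (t - t₀)) *
          G.leaderProfit (G.u₀Hat t) (G.u₁Star t) := by
  have hc := G.continuous_leaderProfit G.continuous_u₀Star G.continuous_u₁Star
  have hi : ∀ A B : ℝ, IntervalIntegrable
      (fun t => Real.exp (-G.r * t) * G.leaderProfit (G.u₀Star t) (G.u₁Star t)) volume A B :=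
    fun A B => Continuous.intervalIntegrable (by fun_prop) _ _
  have hd : ∫ t in t₀..G.T, Real.exp (-G.r * t) * discount t₀ k t *
        G.leaderProfit (G.u₀Hat t) (G.u₁Star t) =
      ∫ t in t₀..G.T, Real.exp (-G.r * t) * Real.exp (-k * (t - t₀)) *
        G.leaderProfit (G.u₀Hat t) (G.u₁Star t) := by
    refine intervalIntegral.integral_congr fun t ht => ?_
    rw [uIcc_of_le ht₀T] at ht
    have : discount t₀ k t = Real.exp (-k * (t - t₀)) := by
      unfold discount
      split_ifs with h
      · simp [le_antisymm h ht.1]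
      · rfl
    simp only [this]
  unfold leaderPayoff defectionPayoff
  rw [hd, ← intervalIntegral.integral_add_adjacent_intervals (hi 0 t₀) (hi t₀ G.T)]
  ring

lemma penaltyExpr_eq {t₀ k : ℝ} (ht₀T : t₀ ≤ G.T) (hk : 0 < k) :
    G.penaltyExpr t₀ k = 64 * G.b *
      (G.leaderPayoff G.u₀Star G.u₁Star -
        G.defectionPayoff t₀ k G.u₀Star G.u₁Star G.u₀Hat) := by
  rw [G.leaderPayoff_sub_defectionPayoff ht₀T]
  have h1 := G.integral_leaderProfit_star t₀
  have h2 := G.integral_leaderProfit_hat t₀ hk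
  unfold penaltyExpr
  linear_combination -h1 - h2

/-! ### A deterring penalty rate exists -/

/-- If `u₀*` vanished on `[t₀, T]`, then `λ*(T) = 0` would give `λ*'(T) = 0`, and `u₀*'(T) = 0`
would give `x*'(T) = 0`. Both modes then vanish, so `x* ≡ x*(0) = 0` and `u₀*(T) = (a' + c')/(2b) >
0`, a contradiction. -/
lemma u₀Star_ne_zero_on (hΔ : G.r ^ 2 < G.Δ) (hγ : 2 * G.γ < G.b * (G.r + 2 * G.δ))
    {t₀ : ℝ} (ht₀T : t₀ < G.T) : ∃ t ∈ Icc t₀ G.T, G.u₀Star t ≠ 0 := by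
  by_contra! h0
  have hT : G.T ∈ Icc t₀ G.T := right_mem_Icc.2 ht₀T.le
  have hb := G.b_pos
  have hlT := G.lamStar_T hΔ hγ
  have huT := h0 G.T hT
  have hx := G.hasDerivAt_xStar_exp G.T
  have hl := G.hasDerivAt_lamStar_exp G.T
  have hl0 := (G.hasDerivAt_lamStar_u₀Star hΔ G.T).unique hl
  rw [hlT, huT] at hl0
  have hu := (((hx.const_mul G.γ).const_sub (G.a' + G.c')).sub hl).div_const (2 * G.b)
  have hu0 : HasDerivWithinAt G.u₀Star 0 (Icc t₀ G.T) G.T :=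
    (hasDerivWithinAt_const G.T (Icc t₀ G.T) (0 : ℝ)).congr h0 huT
  -- `u₀*` is assumed zero only to the left of `T`, so derivatives are compared within the interval.
  have hx0 := (uniqueDiffOn_Icc ht₀T G.T hT).eq_deriv _ hu0 hu.hasDerivWithinAt
  have hx1 : G.X₁ * (G.s₁ * Real.exp (G.s₁ * G.T)) + G.X₂ * (G.s₂ * Real.exp (G.s₂ * G.T)) = 0 := by
    rw [eq_comm, div_eq_zero_iff, or_iff_left (by positivity)] at hx0
    have : G.γ * (G.X₁ * (G.s₁ * Real.exp (G.s₁ * G.T)) +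
        G.X₂ * (G.s₂ * Real.exp (G.s₂ * G.T))) = 0 := by linarith
    exact (mul_eq_zero.1 this).resolve_left G.γ_pos.ne'
  have hq : G.q₂ - G.q₁ ≠ 0 := by
    rw [G.q₂_sub_q₁]
    exact (mul_pos (mul_pos four_pos hb) (G.sqrt_Δ_pos hΔ)).ne'
  have hX₂ : G.X₂ = 0 := by
    have : (G.q₂ - G.q₁) * (G.X₂ * (G.s₂ * Real.exp (G.s₂ * G.T))) = 0 := by
      linear_combination -hl0 - G.q₁ * hx1
    simpa [hq, (G.s₂_pos hΔ).ne'] using this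
  have hX₁ : G.X₁ = 0 := by
    rw [hX₂] at hx1
    simpa [(G.s₁_neg hΔ).ne] using hx1
  have hxT : G.xStar G.T = 0 := by
    rw [← G.xStar_zero, G.xStar_eq, G.xStar_eq, hX₁, hX₂]
    simp
  unfold u₀Star at huT
  rw [hlT, hxT, div_eq_zero_iff, or_iff_left (by positivity)] at huT
  have h1 := G.c₀_lt_a
  have h2 := G.c₀_le_cbar
  unfold a' c' at huT
  linarith

/-- The remaining equilibrium payoff of the leader is positive at every time before the horizon. -/
lemma integral_leaderProfit_star_pos (hΔ : G.r ^ 2 < G.Δ)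
    (hγ : 2 * G.γ < G.b * (G.r + 2 * G.δ)) {t₀ : ℝ} (ht₀T : t₀ < G.T) :
    0 < ∫ t in t₀..G.T, Real.exp (-G.r * t) * G.leaderProfit (G.u₀Star t) (G.u₁Star t) := by
  have hu := G.continuous_u₀Star
  -- Variation of constants for `y' = κ y + u₀*/2`, `y(t₀) = 0`: the response of the stock when the
  -- leader stops producing at `t₀`.
  set y : ℝ → ℝ := fun t =>
    Real.exp (G.κ * t) * ∫ s in t₀..t, Real.exp (-G.κ * s) * (G.u₀Star s / 2) with hydef
  have hyd : ∀ t, HasDerivAt y (G.κ * y t - -G.u₀Star t / 2) t := by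
    intro t
    have hI := intervalIntegral.integral_hasDerivAt_right (a := t₀) (b := t)
      (f := fun s => Real.exp (-G.κ * s) * (G.u₀Star s / 2))
      (Continuous.intervalIntegrable (by fun_prop) _ _)
      (Continuous.stronglyMeasurableAtFilter (by fun_prop) _ _)
      (Continuous.continuousAt (by fun_prop))
    have hE := hasDerivAt_const_mul_exp 1 G.κ t
    simp only [one_mul] at hE
    refine (hE.mul hI).congr_deriv ?_
    have : Real.exp (G.κ * t) * Real.exp (-G.κ * t) = 1 := by
      rw [← Real.exp_add]; simp
    simp only [hydef]
    linear_combination (G.u₀Star t / 2) * this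
  have hyc : Continuous y := continuous_iff_continuousAt.2 fun t => (hyd t).continuousAt
  have hy : ∀ t ∈ Icc t₀ G.T, y t = ∫ s in t₀..t, (G.κ * y s - -G.u₀Star s / 2) := by
    intro t _
    rw [intervalIntegral.integral_eq_sub_of_hasDerivAt (fun s _ => hyd s)
      (Continuous.intervalIntegrable (by fun_prop) _ _)]
    simp [hydef]
  have hdev := G.integral_deviation hΔ hγ ht₀T.le (h := fun t => -G.u₀Star t)
    (memLp_two_of_continuousOn hu.neg.continuousOn) hyc.continuousOn hy
  have hN : 0 < ∫ t in t₀..G.T, Real.exp (-G.r * t) *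
          (G.b * (-G.u₀Star t + G.γ / G.b * y t) ^ 2 +
            G.γ * (G.r + 2 * G.δ - 2 * G.γ / G.b) * y t ^ 2) := by
    have hb := G.b_pos
    have hc := G.curvature_pos hγ
    refine intervalIntegral.integral_pos ht₀T (Continuous.continuousOn (by fun_prop))
      (fun t _ => mul_nonneg (Real.exp_pos _).le (add_nonneg
        (mul_nonneg hb.le (sq_nonneg _)) (mul_nonneg hc.le (sq_nonneg _)))) ?_
    obtain ⟨t, ht, hut⟩ := G.u₀Star_ne_zero_on hΔ hγ ht₀T
    refine ⟨t, ht, mul_pos (Real.exp_pos _) ?_⟩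
    by_cases hyt : y t = 0
    · rw [hyt]
      have : 0 < G.u₀Star t ^ 2 := by positivity
      have := mul_pos hb this
      nlinarith
    · exact add_pos_of_nonneg_of_pos (mul_nonneg hb.le (sq_nonneg _))
        (mul_pos hc (by positivity))
  have hterm : 0 ≤ G.γ * Real.exp (-G.r * G.T) * y G.T ^ 2 :=
    mul_nonneg (mul_nonneg G.γ_pos.le (Real.exp_pos _).le) (sq_nonneg _)
  -- For `h = -u₀*` the terms in `y` cancel, since zero output earns zero at any stock; the
  -- expansion may therefore be taken at `x = x*`.
  have hL : ∫ t in t₀..G.T, Real.exp (-G.r * t) *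
        (G.lamStar t * -G.u₀Star t - G.γ * G.u₀Star t * y t - G.b * (-G.u₀Star t) ^ 2 -
          G.γ * -G.u₀Star t * y t) =
      -2 * ∫ t in t₀..G.T, Real.exp (-G.r * t) * G.leaderProfit (G.u₀Star t) (G.u₁Star t) := by
    rw [← intervalIntegral.integral_const_mul]
    refine intervalIntegral.integral_congr fun t _ => ?_
    have h := G.leaderProfit_reply_sub t 0 (G.xStar t)
    have h0 : G.leaderProfit 0 (G.reply 0 (G.xStar t)) = 0 := by simp [leaderProfit]
    rw [h0] at h
    linear_combination -Real.exp (-G.r * t) * h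
  rw [hL] at hdev
  linarith

lemma exists_integral_hat_lt (t₀ : ℝ) {I : ℝ} (hI : 0 < I) (ht₀T : t₀ ≤ G.T) :
    ∃ k : ℝ, 0 < k ∧
      ∫ t in t₀..G.T, Real.exp (-G.r * t) * Real.exp (-k * (t - t₀)) *
        G.leaderProfit (G.u₀Hat t) (G.u₁Star t) < I := by
  have hc := G.continuous_leaderProfit G.continuous_u₀Hat G.continuous_u₁Star
  obtain ⟨C, hC⟩ := (isCompact_Icc (a := t₀) (b := G.T)).exists_bound_of_continuousOn
    (f := fun t => Real.exp (-G.r * t) * G.leaderProfit (G.u₀Hat t) (G.u₁Star t))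
    (Continuous.continuousOn (by fun_prop))
  have hC0 : 0 ≤ C := (norm_nonneg _).trans (hC t₀ (left_mem_Icc.2 ht₀T))
  -- The integral is at most `C / k = C I / (C + 1) < I`; the `+ 1` keeps `k` positive when `C = 0`.
  set k := (C + 1) / I with hk
  have hk0 : 0 < k := by positivity
  refine ⟨k, hk0, ?_⟩
  calc _ ≤ ∫ t in t₀..G.T, C * Real.exp (k * t₀) * Real.exp (-k * t) := by
        refine intervalIntegral.integral_mono_on ht₀T
          (Continuous.intervalIntegrable (by fun_prop) _ _)
          (Continuous.intervalIntegrable (by fun_prop) _ _) fun t ht => ?_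
        have h1 : Real.exp (-k * (t - t₀)) = Real.exp (k * t₀) * Real.exp (-k * t) := by
          rw [← Real.exp_add]; ring_nf
        have h2 := mul_le_mul_of_nonneg_right ((le_abs_self _).trans (hC t ht))
          (Real.exp_pos (-k * (t - t₀))).le
        rw [h1] at h2 ⊢
        linarith
    _ = C * (Real.exp (k * t₀) * Real.exp (-k * t₀)) *
          ((1 - Real.exp (-k * (G.T - t₀))) / k) := by
        rw [intervalIntegral.integral_const_mul, integral_exp_mul_eq_expQuot, expQuot,
          if_neg (neg_ne_zero.2 hk0.ne'), div_neg]
        ring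
    _ ≤ C * (1 / k) := by
        have : Real.exp (k * t₀) * Real.exp (-k * t₀) = 1 := by
          rw [← Real.exp_add]; simp
        rw [this, mul_one]
        gcongr
        linarith [Real.exp_pos (-k * (G.T - t₀))]
    _ < I := by
        rw [hk, one_div_div, ← mul_div_assoc, div_lt_iff₀ (by positivity)]
        nlinarith

end Duopoly

theorem theorem1p2 (G : Duopoly) (hΔ : G.r ^ 2 < G.Δ)
    (hγ : 2 * G.γ < G.b * (G.r + 2 * G.δ)) (t₀ : ℝ) (ht₀ : 0 ≤ t₀) (ht₀T : t₀ < G.T) :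
    (G.s₁ < 0 ∧ 0 < G.s₂ ∧
      Module.End.HasEigenvalue (Matrix.toLin' G.systemMatrix) G.s₁ ∧
      Module.End.HasEigenvalue (Matrix.toLin' G.systemMatrix) G.s₂) ∧
    G.SolvesBoundaryValueProblem G.xStar G.lamStar ∧
    G.IsKnowledge G.u₁Star G.xStar ∧
    G.IsStackelbergEquilibrium G.u₀Star G.u₁Star ∧
    G.IsOptimalDefection t₀ G.u₁Star G.u₀Hat ∧
    (∀ k : ℝ, 0 < k →
      ((0 ≤ G.penaltyExpr t₀ k ↔
          G.defectionPayoff t₀ k G.u₀Star G.u₁Star G.u₀Hat ≤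
            G.leaderPayoff G.u₀Star G.u₁Star) ∧
        (0 < G.penaltyExpr t₀ k ↔
          G.defectionPayoff t₀ k G.u₀Star G.u₁Star G.u₀Hat <
            G.leaderPayoff G.u₀Star G.u₁Star))) ∧
    ∃ k : ℝ, 0 < k ∧ 0 ≤ G.penaltyExpr t₀ k ∧
      G.defectionPayoff t₀ k G.u₀Star G.u₁Star G.u₀Hat <
        G.leaderPayoff G.u₀Star G.u₁Star := by
  have hpen := fun k hk => G.penaltyExpr_eq (k := k) ht₀T.le hk
  have hb : 0 < 64 * G.b := mul_pos (by norm_num) G.b_pos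
  refine ⟨⟨G.s₁_neg hΔ, G.s₂_pos hΔ, G.hasEigenvalue_s₁ hΔ, G.hasEigenvalue_s₂ hΔ⟩,
    G.solvesBoundaryValueProblem hΔ hγ, G.isKnowledge_xStar hΔ, G.isStackelbergEquilibrium hΔ hγ,
    G.isOptimalDefection ht₀ ht₀T.le, fun k hk => ⟨?_, ?_⟩, ?_⟩
  · rw [hpen k hk, mul_nonneg_iff_of_pos_left hb, sub_nonneg]
  · rw [hpen k hk, mul_pos_iff_of_pos_left hb, sub_pos]
  · obtain ⟨k, hk, hlt⟩ :=
      G.exists_integral_hat_lt t₀ (G.integral_leaderProfit_star_pos hΔ hγ ht₀T) ht₀T.le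
    have h := G.leaderPayoff_sub_defectionPayoff (k := k) ht₀T.le
    have hpos := sub_pos.2 hlt
    rw [← h] at hpos
    refine ⟨k, hk, ?_, sub_pos.1 hpos⟩
    rw [hpen k hk]
    exact (mul_pos hb hpos).le
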